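/- Fix an orthonormal reference basis of a finite-dimensional complex Hilbert space. A state is a positive semidefinite matrix of trace $1$; a state is real if all its entries in the reference basis are real. Let $F(\rho,\sigma)=\bigl(\operatorname{tr}\sqrt{\sqrt\rho\,\sigma\sqrt\rho}\bigr)^2$ be the fidelity, $\Theta_B(\rho,\sigma)=\arccos\sqrt{F(\rho,\sigma)}$ the Bures angle, and $\mathscr M_g(\rho)=1-\max_{\sigma\text{ real}}F(\rho,\sigma)$ the geometric imaginarity, where the maximum is over the real states. Let $T>0$ and let $(\rho_t)_{0\le t\le T}$ be a family of states such that $t\mapsto\sqrt{\rho_t}$ is absolutely continuous on $[0,T]$. Put $$\Delta_I=\arccos\sqrt{1-\mathscr M_g(\rho_T)}-\arccos\sqrt{1-\mathscr M_g(\rho_0)},\qquad \Lambda_g(T)=\frac1T\int_0^T\sqrt{\operatorname{tr}\Bigl(\tfrac{d}{dt}\sqrt{\rho_t}\Bigr)^2}\,dt .$$ Then, for every $t\in[0,T]$, the maximum in $\mathscr M_g(\rho_t)$ is attained and $\arccos\sqrt{1-\mathscr M_g(\rho_t)}=\min_{\sigma\text{ real}}\Theta_B(\rho_t,\sigma)$;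 the derivative $\tfrac{d}{dt}\sqrt{\rho_t}$ exists for almost every $t\in[0,T]$ and the integrand of $\Lambda_g(T)$ is integrable; and $$T\;\ge\;\frac{|\Delta_I|}{\Lambda_g(T)}$$ whenever $\Lambda_g(T)\neq0$, while $\Lambda_g(T)=0$ forces $\Delta_I=0$. -/

import Mathlib

open scoped MatrixOrder ComplexOrder

noncomputable section

namespace Imaginarity

variable {n : Type*} [Fintype n] [DecidableEq n]

/-- A quantum state (density matrix) in the fixed reference basis indexed by `n`. -/
def IsState (ρ : Matrix n n ℂ) : Prop :=
  ρ.PosSemidef ∧ ρ.trace = 1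

/-- The set of real states: density matrices all of whose entries in the reference basis
are real. -/
def realStates (n : Type*) [Fintype n] : Set (Matrix n n ℂ) :=
  {σ | IsState σ ∧ ∀ j k, (σ j k).im = 0}

/-- The root fidelity `√F(ρ, σ) = tr √(√ρ σ √ρ)`. The trace is a nonnegative real number on
states; `re` only changes its type. -/
def rootFidelity (ρ σ : Matrix n n ℂ) : ℝ :=
  (CFC.sqrt (CFC.sqrt ρ * σ * CFC.sqrt ρ)).trace.re

/-- The fidelity `F(ρ, σ) = (tr √(√ρ σ √ρ))²`. -/
def fidelity (ρ σ : Matrix n n ℂ) : ℝ :=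
  rootFidelity ρ σ ^ 2

/-- The Bures angle `arccos √F(ρ, σ)`. -/
def buresAngle (ρ σ : Matrix n n ℂ) : ℝ :=
  Real.arccos (Real.sqrt (fidelity ρ σ))

/-- The geometric imaginarity `1 - max {F(ρ, σ) | σ a real state}`. -/
def geomImaginarity (ρ : Matrix n n ℂ) : ℝ :=
  1 - sSup (fidelity ρ '' realStates n)

/-- The angle `arccos √(1 - M_g(ρ))`. -/
def imaginarityAngle (ρ : Matrix n n ℂ) : ℝ :=
  Real.arccos (Real.sqrt (1 - geomImaginarity ρ))

/-- The instantaneous speed `√(tr (d/dt √ρ_t)²)` of a trajectory. The trace is a nonnegative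
real number for a trajectory of states; `re` only changes its type. -/
def speed (ρ : ℝ → Matrix n n ℂ) (t : ℝ) : ℝ :=
  Real.sqrt ((deriv (fun s => CFC.sqrt (ρ s)) t ^ 2).trace.re)

/-- The time-averaged speed `(1/T) ∫₀ᵀ √(tr (d/dt √ρ_t)²) dt`. -/
def avgSpeed (ρ : ℝ → Matrix n n ℂ) (T : ℝ) : ℝ :=
  1 / T * ∫ t in (0 : ℝ)..T, speed ρ t

end Imaginarity

end

/-!
The proof rests on purifications. A square factor `W` of a state `σ = W Wᴴ` is a unit vector of the
Hilbert-Schmidt space, and the square root `√ρ` of a state is one as well. Uhlmann's theorem says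
that `√F(ρ, σ)` is the maximum of `Re tr (√ρ W)` over the factors `W` of `σ`, so that the Bures
angle from `ρ` to `σ` is the smallest angle between the unit vector `√ρ` and a factor of `σ`
(`buresAngle_le_angle`, `exists_re_trace_sqrt_mul_eq_rootFidelity`). This comes from the polar
decomposition `A U = √(A Aᴴ)`, where `U` is found by maximising `Re tr (A U)` over the compact
unitary group: testing the maximality of `U` against unitaries that change the phase of a single
vector shows that `A U` is positive semidefinite (`exists_unitary_mul_eq_sqrt`).

Two consequences follow. The factors of real states form a compact set, on which the linear
functional `Re tr (√ρ W)` attains its maximum; hence a nearest real state exists. And the triangle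
inequality for angles on the sphere gives
`Θ_B(ρ, σ) ≤ ∠(√ρ, √ρ') + Θ_B(ρ', σ)`, so that the imaginarity angles of `ρ` and `ρ'` differ by at
most `∠(√ρ, √ρ')` (`abs_imaginarityAngle_sub_le`).

It remains to bound the angle between `√ρ_0` and `√ρ_T` by the length of the curve `t ↦ √ρ_t` on the
unit sphere, which is `T` times the average speed because the derivative of a curve of Hermitian
matrices is Hermitian (`speed_eq_norm_deriv`). For an absolutely continuous curve, each chord is
at most the integral of the norm of the derivative; cutting the curve into short pieces, on which
angle and chord agree up to a factor `1 + ε`, and adding the angles gives the bound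
(`AbsolutelyContinuousOnInterval.angle_le_integral_norm_deriv`).
-/

/-! ### Absolutely continuous curves in a finite-dimensional inner product space -/

section AbsolutelyContinuous

open MeasureTheory Set

theorem LipschitzWith.comp_absolutelyContinuousOnInterval {X Y : Type*} [PseudoMetricSpace X]
    [PseudoMetricSpace Y] {K : NNReal} {g : X → Y} (hg : LipschitzWith K g) {f : ℝ → X} {a b : ℝ}
    (hf : AbsolutelyContinuousOnInterval f a b) :
    AbsolutelyContinuousOnInterval (fun t => g (f t)) a b := by
  rw [AbsolutelyContinuousOnInterval] at hf ⊢
  refine squeeze_zero (fun _ => Finset.sum_nonneg fun _ _ => dist_nonneg) (fun E => ?_)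
    (by simpa using hf.const_mul (K : ℝ))
  rw [Finset.mul_sum]
  exact Finset.sum_le_sum fun i _ => hg.dist_le_mul _ _

theorem AbsolutelyContinuousOnInterval.finset_sum {ι F : Type*} [NormedAddCommGroup F]
    (s : Finset ι) {f : ι → ℝ → F} {a b : ℝ}
    (hf : ∀ i ∈ s, AbsolutelyContinuousOnInterval (f i) a b) :
    AbsolutelyContinuousOnInterval (fun t => ∑ i ∈ s, f i t) a b := by
  classical
  induction s using Finset.induction_on with
  | empty =>
    simpa [AbsolutelyContinuousOnInterval] using tendsto_const_nhds
  | insert i s hi ih =>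
    simp only [Finset.sum_insert hi]
    exact (hf i (by simp)).add (ih fun j hj => hf j (by simp [hj]))

section Curve

variable {E : Type*} [NormedAddCommGroup E] [InnerProductSpace ℝ E]
  {X : ℝ → E} {a b : ℝ}

theorem AbsolutelyContinuousOnInterval.inner_left (hX : AbsolutelyContinuousOnInterval X a b)
    (y : E) : AbsolutelyContinuousOnInterval (fun t => inner ℝ y (X t)) a b :=
  (innerSL ℝ y).lipschitz.comp_absolutelyContinuousOnInterval hX

variable [FiniteDimensional ℝ E]

theorem AbsolutelyContinuousOnInterval.ae_differentiableAt_of_finiteDimensional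
    (hX : AbsolutelyContinuousOnInterval X a b) :
    ∀ᵐ t, t ∈ uIcc a b → DifferentiableAt ℝ X t :=
  hX.boundedVariationOn.ae_differentiableAt_of_mem_uIcc

theorem AbsolutelyContinuousOnInterval.ae_deriv_inner (hX : AbsolutelyContinuousOnInterval X a b)
    (y : E) :
    ∀ᵐ t, t ∈ uIcc a b → deriv (fun s => inner ℝ y (X s)) t = inner ℝ y (deriv X t) := by
  filter_upwards [hX.ae_differentiableAt_of_finiteDimensional] with t ht htm
  exact ((innerSL ℝ y).hasFDerivAt.comp_hasDerivAt t (ht htm).hasDerivAt).deriv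

/-- The coordinates of the derivative in an orthonormal basis are derivatives of real absolutely
continuous functions, hence integrable. -/
theorem AbsolutelyContinuousOnInterval.intervalIntegrable_norm_deriv
    (hX : AbsolutelyContinuousOnInterval X a b) :
    IntervalIntegrable (fun t => ‖deriv X t‖) volume a b := by
  have := FiniteDimensional.complete ℝ E
  let e := stdOrthonormalBasis ℝ E
  have hsum : IntervalIntegrable (fun t => ∑ i, |deriv (fun s => inner ℝ (e i) (X s)) t|)
      volume a b := by
    have h := IntervalIntegrable.sum (μ := volume) (a := a) (b := b) Finset.univ
      (f := fun i t => |deriv (fun s => inner ℝ (e i) (X s)) t|)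
      fun i _ => (hX.inner_left (e i)).intervalIntegrable_deriv.abs
    have he : (∑ i, fun t => |deriv (fun s => inner ℝ (e i) (X s)) t|) =
        fun t => ∑ i, |deriv (fun s => inner ℝ (e i) (X s)) t| := by
      ext t
      simp
    rwa [he] at h
  have hae : ∀ᵐ t, t ∈ uIcc a b → ∀ i,
      deriv (fun s => inner ℝ (e i) (X s)) t = inner ℝ (e i) (deriv X t) := by
    have := ae_all_iff.2 fun i => hX.ae_deriv_inner (e i)
    filter_upwards [this] with t ht htm i using ht i htm
  refine hsum.mono_fun (stronglyMeasurable_deriv X).norm.aestronglyMeasurable ?_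
  rw [Filter.EventuallyLE, ae_restrict_iff' measurableSet_uIoc]
  filter_upwards [hae] with t ht htm
  rw [norm_norm, Real.norm_of_nonneg (Finset.sum_nonneg fun _ _ => abs_nonneg _)]
  conv_lhs => rw [← e.sum_repr' (deriv X t)]
  refine (norm_sum_le _ _).trans (Finset.sum_le_sum fun i _ => ?_)
  rw [norm_smul, e.norm_eq_one, mul_one, Real.norm_eq_abs, ht (uIoc_subset_uIcc htm) i]

/-- Applying the real fundamental theorem of calculus to the component of the curve along its
chord bounds the chord by the length. -/
theorem AbsolutelyContinuousOnInterval.norm_sub_le_integral_norm_deriv (hab : a ≤ b)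
    (hX : AbsolutelyContinuousOnInterval X a b) :
    ‖X b - X a‖ ≤ ∫ t in a..b, ‖deriv X t‖ := by
  set y := X b - X a with hy
  have h1 : ‖y‖ * ‖y‖ ≤ ‖y‖ * ∫ t in a..b, ‖deriv X t‖ := by
    rw [← real_inner_self_eq_norm_mul_norm]
    nth_rewrite 2 [hy]
    rw [inner_sub_right, ← (hX.inner_left y).integral_deriv_eq_sub,
      ← intervalIntegral.integral_const_mul]
    refine intervalIntegral.integral_mono_ae_restrict hab
      (hX.inner_left y).intervalIntegrable_deriv (hX.intervalIntegrable_norm_deriv.const_mul _) ?_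
    rw [Filter.EventuallyLE, ae_restrict_iff' measurableSet_Icc]
    filter_upwards [hX.ae_deriv_inner y] with t ht htm
    rw [ht (by rwa [uIcc_of_le hab])]
    exact real_inner_le_norm _ _
  rcases (norm_nonneg y).eq_or_lt with h0 | h0
  · rw [← h0]
    exact intervalIntegral.integral_nonneg hab fun _ _ => norm_nonneg _
  · exact le_of_mul_le_mul_left h1 h0

end Curve

/-! ### Angles between unit vectors -/

section Angle

variable {E : Type*} [NormedAddCommGroup E] [InnerProductSpace ℝ E]

theorem InnerProductGeometry.norm_sub_eq_two_mul_sin_half_angle {u v : E} (hu : ‖u‖ = 1)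
    (hv : ‖v‖ = 1) : ‖u - v‖ = 2 * Real.sin (InnerProductGeometry.angle u v / 2) := by
  set θ := InnerProductGeometry.angle u v with hθ
  have h0 : 0 ≤ θ := InnerProductGeometry.angle_nonneg _ _
  have h1 : θ ≤ Real.pi := InnerProductGeometry.angle_le_pi _ _
  have hs : 0 ≤ Real.sin (θ / 2) := Real.sin_nonneg_of_nonneg_of_le_pi (by linarith) (by linarith)
  have hc : inner ℝ u v = Real.cos θ := by
    rw [InnerProductGeometry.inner_eq_cos_angle_of_norm_eq_one hu hv]
  rw [← sq_eq_sq₀ (norm_nonneg _) (by positivity), norm_sub_sq_real, hu, hv, hc, mul_pow,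
    Real.sin_sq_eq_half_sub, mul_div_cancel₀ θ (by norm_num : (2:ℝ) ≠ 0)]
  ring

/-- To first order, the angle between two unit vectors is at most their distance. -/
theorem InnerProductGeometry.exists_angle_le_mul_norm_sub {ε : ℝ} (hε : 0 < ε) :
    ∃ δ > 0, ∀ u v : E, ‖u‖ = 1 → ‖v‖ = 1 → ‖u - v‖ < δ →
      InnerProductGeometry.angle u v ≤ (1 + ε) * ‖u - v‖ := by
  have hp := Real.pi_pos
  have key : ∃ δ > 0, ∀ θ, 0 ≤ θ → θ ≤ δ → θ ≤ (1 + ε) * (2 * Real.sin (θ / 2)) := by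
    refine ⟨min 1 ε, lt_min one_pos hε, fun θ h0 h1 => ?_⟩
    have h2 := h1.trans (min_le_left _ _)
    have h3 := h1.trans (min_le_right _ _)
    rcases h0.eq_or_lt with rfl | h0
    · simp
    have hs := Real.sin_gt_sub_cube (x := θ / 2) (by positivity)
    have : θ * (1 - θ / 24) ≤ 2 * Real.sin (θ / 2) := by
      have h6 : θ ^ 3 ≤ θ ^ 2 := by nlinarith [pow_pos h0 2]
      nlinarith
    have h4 : θ ≤ (1 + θ) * (θ * (1 - θ / 24)) := by nlinarith [mul_pos h0 h0]
    have h5 : 0 ≤ θ * (1 - θ / 24) := mul_nonneg h0.le (by linarith)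
    nlinarith
  obtain ⟨δ, hδ, h⟩ := key
  refine ⟨2 / Real.pi * δ, by positivity, fun u v hu hv huv => ?_⟩
  set θ := InnerProductGeometry.angle u v with hθ
  have h0 : 0 ≤ θ := InnerProductGeometry.angle_nonneg _ _
  have h1 : θ ≤ Real.pi := InnerProductGeometry.angle_le_pi _ _
  rw [InnerProductGeometry.norm_sub_eq_two_mul_sin_half_angle hu hv, ← hθ] at huv ⊢
  refine h θ h0 ?_
  -- Jordan's inequality turns the bound on the chord into a bound on the angle.
  have hj := Real.mul_le_sin (x := θ / 2) (by linarith) (by linarith)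
  have h2 : 2 / Real.pi * θ < 2 / Real.pi * δ := by linarith
  exact (lt_of_mul_lt_mul_left h2 (by positivity)).le

/-- On the unit sphere, the angle between the end points of an absolutely continuous curve is at
most the length of the curve. -/
theorem AbsolutelyContinuousOnInterval.angle_le_integral_norm_deriv [FiniteDimensional ℝ E]
    {X : ℝ → E} {T : ℝ} (hT : 0 < T) (hX : AbsolutelyContinuousOnInterval X 0 T)
    (hnorm : ∀ t ∈ Icc 0 T, ‖X t‖ = 1) :
    InnerProductGeometry.angle (X 0) (X T) ≤ ∫ t in (0 : ℝ)..T, ‖deriv X t‖ := by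
  set ℓ := fun s => ∫ t in (0 : ℝ)..s, ‖deriv X t‖ with hℓ
  have hℓ0 : 0 ≤ ℓ T := intervalIntegral.integral_nonneg hT.le fun _ _ => norm_nonneg _
  suffices h : ∀ ε > 0, InnerProductGeometry.angle (X 0) (X T) ≤ (1 + ε) * ℓ T by
    refine le_of_forall_pos_le_add fun η hη => (h (η / (ℓ T + 1)) (by positivity)).trans ?_
    have : η / (ℓ T + 1) * ℓ T ≤ η := by
      rw [div_mul_eq_mul_div, div_le_iff₀ (by positivity)]
      nlinarith
    change _ ≤ ℓ T + η
    linarith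
  intro ε hε
  obtain ⟨δ, hδ, hang⟩ := InnerProductGeometry.exists_angle_le_mul_norm_sub (E := E) hε
  obtain ⟨η, hη, huc⟩ := Metric.uniformContinuousOn_iff.1 hX.uniformContinuousOn δ hδ
  rw [uIcc_of_le hT.le] at huc
  -- Equidistant subdivision into `N` pieces, each of length below the continuity threshold `η`.
  obtain ⟨N, hN⟩ := exists_nat_gt (T / η)
  have hNpos : (0 : ℝ) < N := lt_of_le_of_lt (by positivity) hN
  have hstep : T / N < η := by
    rw [div_lt_iff₀ hη] at hN
    rw [div_lt_iff₀ hNpos]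
    linarith
  have hstep0 : 0 < T / N := by positivity
  have main : ∀ k : ℕ, k ≤ N →
      InnerProductGeometry.angle (X 0) (X (k * (T / N))) ≤ (1 + ε) * ℓ (k * (T / N)) := by
    intro k
    induction k with
    | zero =>
      intro _
      have : X 0 ≠ 0 := fun h => by simpa [h] using hnorm 0 ⟨le_rfl, hT.le⟩
      simp [hℓ, InnerProductGeometry.angle_self this]
    | succ k ih =>
      intro hk
      have hend : (N : ℝ) * (T / N) = T := by field_simp
      have hmem : ∀ m : ℕ, m ≤ N → (m : ℝ) * (T / N) ∈ Icc 0 T := fun m hm =>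
        ⟨by positivity,
        (mul_le_mul_of_nonneg_right (by exact_mod_cast hm) hstep0.le).trans hend.le⟩
      set s := (k : ℝ) * (T / N) with hs
      set t := ((k + 1 : ℕ) : ℝ) * (T / N) with ht
      have hsm : s ∈ Icc 0 T := hmem k (by omega)
      have htm : t ∈ Icc 0 T := hmem (k + 1) hk
      have hst : t = s + T / N := by rw [hs, ht]; push_cast; ring
      have hle : s ≤ t := by linarith
      have hX' : AbsolutelyContinuousOnInterval X s t := hX.mono (by
        rw [uIcc_of_le hle, uIcc_of_le hT.le]
        exact Icc_subset_Icc hsm.1 htm.2)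
      have hX0 : AbsolutelyContinuousOnInterval X 0 s := hX.mono (by
        rw [uIcc_of_le hsm.1, uIcc_of_le hT.le]
        exact Icc_subset_Icc le_rfl hsm.2)
      have h1 : InnerProductGeometry.angle (X s) (X t) ≤ (1 + ε) * ‖X s - X t‖ := by
        refine hang _ _ (hnorm s hsm) (hnorm t htm) ?_
        rw [← dist_eq_norm]
        refine huc s hsm t htm ?_
        rw [Real.dist_eq, abs_sub_comm, abs_of_nonneg (by linarith)]
        linarith
      have h2 := hX'.norm_sub_le_integral_norm_deriv hle
      have h3 : ℓ s + ∫ r in s..t, ‖deriv X r‖ = ℓ t :=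
        intervalIntegral.integral_add_adjacent_intervals hX0.intervalIntegrable_norm_deriv
          hX'.intervalIntegrable_norm_deriv
      rw [norm_sub_rev] at h2
      calc InnerProductGeometry.angle (X 0) (X t)
          ≤ InnerProductGeometry.angle (X 0) (X s) + InnerProductGeometry.angle (X s) (X t) :=
            InnerProductGeometry.angle_le_angle_add_angle _ _ _
        _ ≤ (1 + ε) * ℓ s + (1 + ε) * ∫ r in s..t, ‖deriv X r‖ := by
            refine add_le_add (ih (by omega)) (h1.trans ?_)
            gcongr
        _ = (1 + ε) * ℓ t := by rw [← h3]; ring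
  have := main N le_rfl
  rwa [mul_div_cancel₀ T hNpos.ne'] at this

end Angle

end AbsolutelyContinuous

/-! ### Polar decomposition by maximising a trace over the unitary group -/

namespace Matrix

variable {n : Type*} [Fintype n] [DecidableEq n]

/-- Over the complex numbers, nonnegativity of the quadratic form implies hermiticity. -/
theorem posSemidef_of_forall_dotProduct_mulVec_nonneg {B : Matrix n n ℂ}
    (h : ∀ x : n → ℂ, 0 ≤ star x ⬝ᵥ (B *ᵥ x)) : B.PosSemidef := by
  rw [← Matrix.isPositive_toEuclideanLin_iff, LinearMap.isPositive_iff_complex]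
  intro x
  have hx : inner ℂ (B.toEuclideanLin x) x = star (star x.ofLp ⬝ᵥ (B *ᵥ x.ofLp)) := by
    rw [EuclideanSpace.inner_eq_star_dotProduct, Matrix.ofLp_toLpLin, toLin'_apply,
      Matrix.star_dotProduct, star_star, dotProduct_comm]
  have h0 : 0 ≤ inner ℂ (B.toEuclideanLin x) x := by
    rw [hx]
    exact star_nonneg_iff.2 (h x.ofLp)
  obtain ⟨h1, h2⟩ := Complex.nonneg_iff.1 h0
  exact ⟨Complex.ext (by simp) (by simp [← h2]), h1⟩

/-- The unitary matrix that multiplies `x` by the phase `z` and fixes the orthogonal complement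
of `x`. -/
theorem one_add_smul_vecMulVec_mem_unitaryGroup {x : n → ℂ} (hx : x ≠ 0) {z : ℂ}
    (hz : ‖z‖ = 1) :
    1 + ((z - 1) / (star x ⬝ᵥ x)) • vecMulVec x (star x) ∈ unitaryGroup n ℂ := by
  have hr : star x ⬝ᵥ x ≠ 0 := by simpa using hx
  have hrs : star (star x ⬝ᵥ x) = star x ⬝ᵥ x := (Matrix.star_dotProduct x x).symm
  have hzz : z * star z = 1 := by
    simpa [hz] using Complex.mul_conj' z
  set r := star x ⬝ᵥ x with hrdef
  set P := vecMulVec x (star x) with hP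
  have hPs : star P = P := by
    rw [hP, Matrix.star_eq_conjTranspose, conjTranspose_vecMulVec, star_star]
  have hPP : P * P = r • P := by
    rw [hP, vecMulVec_mul_vecMulVec, ← hrdef, vecMulVec_smul]
  rw [mem_unitaryGroup_iff, star_add, star_one, star_smul, hPs, add_mul, mul_add, mul_add, one_mul,
    mul_one, one_mul, smul_mul_smul_comm, hPP, smul_smul, add_assoc, ← add_smul, ← add_smul]
  rw [star_div₀, hrs, star_sub, star_one]
  convert add_zero _
  rw [smul_eq_zero]
  left
  field_simp
  linear_combination hzz

theorem isCompact_unitaryGroup : IsCompact (unitaryGroup n ℂ : Set (Matrix n n ℂ)) := by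
  refine (isCompact_univ_pi fun _ : n => isCompact_univ_pi fun _ : n =>
    isCompact_closedBall (0 : ℂ) 1).of_isClosed_subset ?_ ?_
  · have : (unitaryGroup n ℂ : Set (Matrix n n ℂ)) = {U | U * star U = 1} := by
      ext U
      exact mem_unitaryGroup_iff
    rw [this]
    exact isClosed_eq (by fun_prop) continuous_const
  · intro U hU i _ j _
    rw [mem_closedBall_zero_iff]
    exact entry_norm_bound_of_unitary hU i j

/-- If right multiplication of `B` by a unitary matrix never increases the real part of the trace,
then `B` is positive semidefinite. -/
theorem posSemidef_of_forall_re_trace_mul_le {B : Matrix n n ℂ}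
    (h : ∀ V ∈ unitaryGroup n ℂ, (B * V).trace.re ≤ B.trace.re) : B.PosSemidef := by
  refine posSemidef_of_forall_dotProduct_mulVec_nonneg fun x => ?_
  by_cases hx : x = 0
  · simp [hx]
  set q := star x ⬝ᵥ (B *ᵥ x) with hq
  by_cases hq0 : q = 0
  · rw [hq0]
  have hqn : (0 : ℝ) < ‖q‖ := norm_pos_iff.2 hq0
  have hr0 : 0 < star x ⬝ᵥ x := dotProduct_star_self_pos_iff.2 hx
  obtain ⟨hre, him⟩ := Complex.pos_iff.1 hr0
  have hr : star x ⬝ᵥ x = ((star x ⬝ᵥ x).re : ℂ) := Complex.ext (by simp) (by simp [← him])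
  -- The phase `z` that rotates `q` onto the positive half-line.
  have hz : ‖star q / (‖q‖ : ℂ)‖ = 1 := by
    simp [hqn.ne']
  have hV := h _ (one_add_smul_vecMulVec_mem_unitaryGroup hx hz)
  have htr : (B * vecMulVec x (star x)).trace = q := by
    rw [mul_vecMulVec, trace_vecMulVec, dotProduct_comm]
  have hzq : star q / (‖q‖ : ℂ) * q = ‖q‖ := by
    have : star q * q = (‖q‖ : ℂ) ^ 2 := Complex.conj_mul' q
    rw [div_mul_eq_mul_div, this, sq, mul_div_assoc, div_self (by exact_mod_cast hqn.ne'), mul_one]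
  rw [mul_add, mul_one, trace_add, mul_smul_comm, trace_smul, htr, smul_eq_mul, hr,
    div_mul_eq_mul_div, sub_mul, hzq, one_mul, Complex.add_re, Complex.div_ofReal_re,
    Complex.sub_re, Complex.ofReal_re] at hV
  have h1 : (‖q‖ - q.re) / (star x ⬝ᵥ x).re ≤ 0 := by linarith
  rw [div_le_iff₀ hre, zero_mul, sub_nonpos] at h1
  have h2 : q.re = ‖q‖ := le_antisymm (Complex.re_le_norm q) h1
  have h3 := Complex.sq_norm_sub_sq_re q
  rw [h2, sub_self] at h3
  rw [Complex.nonneg_iff]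
  exact ⟨by rw [h2]; exact hqn.le, (pow_eq_zero_iff two_ne_zero).1 h3.symm |>.symm⟩

/-- Polar decomposition `A = √(A Aᴴ) Uᴴ`, with the variational characterisation of the trace
norm. -/
theorem exists_unitary_mul_eq_sqrt (A : Matrix n n ℂ) :
    ∃ U ∈ unitaryGroup n ℂ, A * U = CFC.sqrt (A * Aᴴ) ∧
      ∀ V ∈ unitaryGroup n ℂ, (A * V).trace.re ≤ (CFC.sqrt (A * Aᴴ)).trace.re := by
  obtain ⟨U, hU, hmax⟩ := isCompact_unitaryGroup.exists_isMaxOn (s := unitaryGroup n ℂ)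
    (f := fun V : Matrix n n ℂ => (A * V).trace.re) ⟨1, one_mem _⟩
    (Continuous.continuousOn (by fun_prop))
  have hpos : (A * U).PosSemidef := posSemidef_of_forall_re_trace_mul_le fun V hV => by
    rw [Matrix.mul_assoc]
    exact hmax (mul_mem hU hV)
  have hsqrt : CFC.sqrt (A * Aᴴ) = A * U := by
    refine CFC.sqrt_unique ?_ hpos.nonneg
    nth_rewrite 2 [← hpos.isHermitian.eq]
    rw [conjTranspose_mul, Matrix.mul_assoc, ← Matrix.mul_assoc U, ← star_eq_conjTranspose U,
      mem_unitaryGroup_iff.1 hU, Matrix.one_mul]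
  exact ⟨U, hU, hsqrt.symm, fun V hV => hsqrt ▸ hmax hV⟩

end Matrix

/-! ### Root fidelity as a maximum over purifications -/

namespace Imaginarity

open Matrix

variable {n : Type*} [Fintype n] [DecidableEq n]

theorem conjTranspose_sqrt (ρ : Matrix n n ℂ) : (CFC.sqrt ρ)ᴴ = CFC.sqrt ρ :=
  (CFC.sqrt_nonneg ρ).posSemidef.isHermitian.eq

theorem sqrt_mul_mul_conjTranspose (ρ W : Matrix n n ℂ) :
    CFC.sqrt ρ * (W * Wᴴ) * CFC.sqrt ρ = (CFC.sqrt ρ * W) * (CFC.sqrt ρ * W)ᴴ := by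
  rw [conjTranspose_mul, conjTranspose_sqrt]
  simp only [Matrix.mul_assoc]

theorem rootFidelity_nonneg (ρ σ : Matrix n n ℂ) : 0 ≤ rootFidelity ρ σ :=
  (Complex.nonneg_iff.1 (CFC.sqrt_nonneg _).posSemidef.trace_nonneg).1

theorem sqrt_fidelity (ρ σ : Matrix n n ℂ) : Real.sqrt (fidelity ρ σ) = rootFidelity ρ σ :=
  Real.sqrt_sq (rootFidelity_nonneg ρ σ)

/-- The easy half of Uhlmann's theorem. -/
theorem re_trace_sqrt_mul_le_rootFidelity (ρ W : Matrix n n ℂ) :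
    (CFC.sqrt ρ * W).trace.re ≤ rootFidelity ρ (W * Wᴴ) := by
  obtain ⟨-, -, -, h⟩ := exists_unitary_mul_eq_sqrt (CFC.sqrt ρ * W)
  rw [rootFidelity, sqrt_mul_mul_conjTranspose]
  simpa using h 1 (one_mem _)

/-- The attainment half of Uhlmann's theorem. -/
theorem exists_re_trace_sqrt_mul_eq_rootFidelity (ρ : Matrix n n ℂ) {σ : Matrix n n ℂ}
    (hσ : σ.PosSemidef) :
    ∃ W, W * Wᴴ = σ ∧ (CFC.sqrt ρ * W).trace.re = rootFidelity ρ σ := by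
  have hss : CFC.sqrt σ * (CFC.sqrt σ)ᴴ = σ := by
    rw [conjTranspose_sqrt, CFC.sqrt_mul_sqrt_self σ hσ.nonneg]
  obtain ⟨U, hU, h, -⟩ := exists_unitary_mul_eq_sqrt (CFC.sqrt ρ * CFC.sqrt σ)
  refine ⟨CFC.sqrt σ * U, ?_, ?_⟩
  · rw [conjTranspose_mul, Matrix.mul_assoc, ← Matrix.mul_assoc U, ← star_eq_conjTranspose U,
      mem_unitaryGroup_iff.1 hU, Matrix.one_mul, hss]
  · rw [← Matrix.mul_assoc, h, ← sqrt_mul_mul_conjTranspose, hss, rootFidelity]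

end Imaginarity

namespace Imaginarity

open Matrix InnerProductGeometry MeasureTheory Set

variable {n : Type*} [Fintype n] [DecidableEq n]

/-! ### The Hilbert-Schmidt space -/

/-- A matrix as a vector of the Hilbert-Schmidt space, regarded as a real inner product space. -/
def hsVec (A : Matrix n n ℂ) : EuclideanSpace ℂ (n × n) :=
  WithLp.toLp 2 fun p => A p.1 p.2

omit [DecidableEq n] in
theorem inner_hsVec (A B : Matrix n n ℂ) :
    inner ℝ (hsVec A) (hsVec B) = (Aᴴ * B).trace.re := by
  rw [PiLp.inner_apply, Fintype.sum_prod_type_right, trace, Complex.re_sum]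
  refine Finset.sum_congr rfl fun j _ => ?_
  rw [diag_apply, mul_apply, Complex.re_sum]
  refine Finset.sum_congr rfl fun i _ => ?_
  rw [Complex.inner, conjTranspose_apply, mul_comm]
  rfl

omit [DecidableEq n] in
theorem norm_hsVec_sq (A : Matrix n n ℂ) : ‖hsVec A‖ ^ 2 = (A * Aᴴ).trace.re := by
  rw [← real_inner_self_eq_norm_sq, inner_hsVec, trace_mul_comm]

omit [DecidableEq n] in
theorem norm_hsVec_eq_one {A : Matrix n n ℂ} (h : IsState (A * Aᴴ)) : ‖hsVec A‖ = 1 := by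
  have := norm_hsVec_sq A
  rw [h.2, Complex.one_re] at this
  exact (pow_eq_one_iff_of_nonneg (norm_nonneg _) two_ne_zero).1 this

theorem norm_hsVec_sqrt {ρ : Matrix n n ℂ} (h : IsState ρ) : ‖hsVec (CFC.sqrt ρ)‖ = 1 := by
  refine norm_hsVec_eq_one ?_
  rwa [conjTranspose_sqrt, CFC.sqrt_mul_sqrt_self ρ h.1.nonneg]

/-! ### The Bures angle -/

theorem angle_hsVec_sqrt {ρ W : Matrix n n ℂ} (hρ : IsState ρ) (hW : IsState (W * Wᴴ)) :
    angle (hsVec (CFC.sqrt ρ)) (hsVec W) = Real.arccos (CFC.sqrt ρ * W).trace.re := by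
  rw [angle, norm_hsVec_sqrt hρ, norm_hsVec_eq_one hW, inner_hsVec, conjTranspose_sqrt, mul_one,
    div_one]

theorem buresAngle_le_angle {ρ W : Matrix n n ℂ} (hρ : IsState ρ) (hW : IsState (W * Wᴴ)) :
    buresAngle ρ (W * Wᴴ) ≤ angle (hsVec (CFC.sqrt ρ)) (hsVec W) := by
  rw [angle_hsVec_sqrt hρ hW, buresAngle, sqrt_fidelity]
  exact Real.arccos_le_arccos (re_trace_sqrt_mul_le_rootFidelity ρ W)

/-- The triangle inequality for the Bures angle, with the distance between the first two states
relaxed to the Hilbert-Schmidt angle between their square roots. -/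
theorem buresAngle_le_angle_add_buresAngle {ρ ρ' σ : Matrix n n ℂ} (hρ : IsState ρ)
    (hρ' : IsState ρ') (hσ : IsState σ) :
    buresAngle ρ σ ≤
      angle (hsVec (CFC.sqrt ρ)) (hsVec (CFC.sqrt ρ')) + buresAngle ρ' σ := by
  obtain ⟨W, rfl, hW⟩ := exists_re_trace_sqrt_mul_eq_rootFidelity ρ' hσ.1
  have h : buresAngle ρ' (W * Wᴴ) = angle (hsVec (CFC.sqrt ρ')) (hsVec W) := by
    rw [angle_hsVec_sqrt hρ' hσ, buresAngle, sqrt_fidelity, hW]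
  rw [h]
  exact (buresAngle_le_angle hρ hσ).trans (angle_le_angle_add_angle _ _ _)

/-! ### The nearest real state -/

theorem realStates_nonempty [Nonempty n] : (realStates n).Nonempty := by
  obtain ⟨i⟩ := ‹Nonempty n›
  refine ⟨diagonal (Pi.single i 1), ⟨PosSemidef.diagonal ?_, ?_⟩, fun j k => ?_⟩
  · exact Pi.single_nonneg.2 zero_le_one
  · simp [trace_diagonal]
  · by_cases hjk : j = k
    · subst hjk
      by_cases hj : j = i
      · subst hj; simp
      · simp [hj]
    · simp [hjk]

omit [DecidableEq n] in
theorem IsState.nonempty {ρ : Matrix n n ℂ} (h : IsState ρ) : Nonempty n := by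
  by_contra hn
  rw [not_nonempty_iff] at hn
  simpa [trace] using h.2

omit [DecidableEq n] in
/-- The square factors `W` of the real states `W Wᴴ` form a compact set. -/
theorem isCompact_setOf_mul_conjTranspose_mem_realStates :
    IsCompact {W : Matrix n n ℂ | W * Wᴴ ∈ realStates n} := by
  refine (isCompact_univ_pi fun _ : n => isCompact_univ_pi fun _ : n =>
    isCompact_closedBall (0 : ℂ) 1).of_isClosed_subset ?_ ?_
  · have : {W : Matrix n n ℂ | W * Wᴴ ∈ realStates n} =
        {W | (W * Wᴴ).trace = 1} ∩ ⋂ j, ⋂ k, {W | ((W * Wᴴ) j k).im = 0} := by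
      ext W
      simp only [realStates, IsState, mem_ofPred_eq, mem_inter_iff, mem_iInter]
      exact and_congr_left fun _ => and_iff_right (posSemidef_self_mul_conjTranspose W)
    rw [this]
    refine (isClosed_eq (by fun_prop) continuous_const).inter
      (isClosed_iInter fun j => isClosed_iInter fun k => isClosed_eq ?_ continuous_const)
    exact Complex.continuous_im.comp
      ((continuous_id.matrix_mul continuous_id.matrix_conjTranspose).matrix_elem j k)
  · intro W hW i _ j _
    rw [mem_closedBall_zero_iff]
    calc ‖W i j‖ = ‖(hsVec W).ofLp (i, j)‖ := rfl
      _ ≤ ‖hsVec W‖ := PiLp.norm_apply_le _ _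
      _ = 1 := norm_hsVec_eq_one hW.1

/-- A nearest real state is `W Wᴴ`, where the factor `W` of a real state maximises `Re tr (√ρ W)`. -/
theorem exists_realState_forall_rootFidelity_le [Nonempty n] (ρ : Matrix n n ℂ) :
    ∃ σ ∈ realStates n, ∀ τ ∈ realStates n, rootFidelity ρ τ ≤ rootFidelity ρ σ := by
  obtain ⟨σ₀, hσ₀⟩ := realStates_nonempty (n := n)
  obtain ⟨W₀, hW₀, -⟩ := exists_re_trace_sqrt_mul_eq_rootFidelity ρ hσ₀.1.1
  obtain ⟨W, hW, hmax⟩ :=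
    (isCompact_setOf_mul_conjTranspose_mem_realStates (n := n)).exists_isMaxOn
      (f := fun W => (CFC.sqrt ρ * W).trace.re) ⟨W₀, by rwa [mem_ofPred_eq, hW₀]⟩
      (Continuous.continuousOn (by fun_prop))
  refine ⟨W * Wᴴ, hW, fun τ hτ => ?_⟩
  obtain ⟨V, rfl, hV⟩ := exists_re_trace_sqrt_mul_eq_rootFidelity ρ hτ.1.1
  exact hV ▸ (hmax hτ).trans (re_trace_sqrt_mul_le_rootFidelity ρ W)

theorem isGreatest_fidelity_and_isLeast_buresAngle [Nonempty n] (ρ : Matrix n n ℂ) :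
    IsGreatest (fidelity ρ '' realStates n) (1 - geomImaginarity ρ) ∧
      IsLeast (buresAngle ρ '' realStates n) (imaginarityAngle ρ) := by
  obtain ⟨σ, hσ, hmax⟩ := exists_realState_forall_rootFidelity_le ρ
  have hg : IsGreatest (fidelity ρ '' realStates n) (fidelity ρ σ) := by
    refine ⟨mem_image_of_mem _ hσ, ?_⟩
    rintro _ ⟨τ, hτ, rfl⟩
    exact pow_le_pow_left₀ (rootFidelity_nonneg ρ τ) (hmax τ hτ) 2
  have he : 1 - geomImaginarity ρ = fidelity ρ σ := by
    rw [geomImaginarity, hg.csSup_eq, sub_sub_cancel]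
  rw [imaginarityAngle, he]
  refine ⟨hg, mem_image_of_mem _ hσ, ?_⟩
  rintro _ ⟨τ, hτ, rfl⟩
  exact Real.arccos_le_arccos (Real.sqrt_le_sqrt (hg.2 (mem_image_of_mem _ hτ)))

theorem imaginarityAngle_sub_le {ρ ρ' : Matrix n n ℂ} (hρ : IsState ρ) (hρ' : IsState ρ') :
    imaginarityAngle ρ - imaginarityAngle ρ' ≤
      angle (hsVec (CFC.sqrt ρ)) (hsVec (CFC.sqrt ρ')) := by
  have := hρ.nonempty
  obtain ⟨σ, hσ, h⟩ := (isGreatest_fidelity_and_isLeast_buresAngle ρ').2.1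
  have h1 := (isGreatest_fidelity_and_isLeast_buresAngle ρ).2.2 (mem_image_of_mem _ hσ)
  have h2 := buresAngle_le_angle_add_buresAngle hρ hρ' hσ.1
  linarith

theorem abs_imaginarityAngle_sub_le {ρ ρ' : Matrix n n ℂ} (hρ : IsState ρ) (hρ' : IsState ρ') :
    |imaginarityAngle ρ - imaginarityAngle ρ'| ≤
      angle (hsVec (CFC.sqrt ρ')) (hsVec (CFC.sqrt ρ)) :=
  abs_sub_le_iff.2 ⟨angle_comm (hsVec (CFC.sqrt ρ)) _ ▸ imaginarityAngle_sub_le hρ hρ',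
    imaginarityAngle_sub_le hρ' hρ⟩

/-! ### The speed of a trajectory -/

theorem absolutelyContinuousOnInterval_hsVec {M : ℝ → Matrix n n ℂ} {a b : ℝ}
    (hM : ∀ j k, AbsolutelyContinuousOnInterval (fun t => M t j k) a b) :
    AbsolutelyContinuousOnInterval (fun t => hsVec (M t)) a b := by
  have hsum : (fun t => hsVec (M t)) =
      fun t => ∑ p : n × n, EuclideanSpace.single p (M t p.1 p.2) := by
    ext t p
    simp [hsVec, Pi.single_apply]
  rw [hsum]
  refine AbsolutelyContinuousOnInterval.finset_sum _ fun p _ => ?_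
  have hL : LipschitzWith 1 fun z : ℂ => (EuclideanSpace.single p z : EuclideanSpace ℂ (n × n)) :=
    LipschitzWith.of_dist_le_mul fun z w => by simp
  exact hL.comp_absolutelyContinuousOnInterval (hM p.1 p.2)

omit [DecidableEq n] in
/-- The derivative of a curve of matrices, which is taken in the product topology, can be computed
in the Hilbert-Schmidt space. -/
theorem differentiableAt_and_deriv_of_hsVec {M : ℝ → Matrix n n ℂ} {M' : Matrix n n ℂ} {t : ℝ}
    (h : HasDerivAt (fun s => hsVec (M s)) (hsVec M') t) :
    DifferentiableAt ℝ M t ∧ deriv M t = M' ∧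
      ∀ j k, HasDerivAt (fun s => M s j k) (M' j k) t := by
  have hentry : ∀ j k, HasDerivAt (fun s => M s j k) (M' j k) t := fun j k =>
    (PiLp.proj 2 (𝕜 := ℝ) (fun _ : n × n => ℂ) (j, k)).hasFDerivAt.comp_hasDerivAt t h
  -- The differentiation lemmas need a normed space, which matrices are only as plain functions.
  have hd : HasDerivAt (F := n → n → ℂ) M M' t :=
    hasDerivAt_pi.2 fun j => hasDerivAt_pi.2 fun k => hentry j k
  have h1 := hd.differentiableAt
  have h2 := hd.deriv
  exact ⟨h1, h2, hentry⟩

/-- The speed is the Hilbert-Schmidt norm of the velocity of `√ρ_t`: the velocity `M'` is Hermitian,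
so `tr (M' ^ 2) = tr (M' M'ᴴ)`. -/
theorem speed_eq_norm_deriv {ρ : ℝ → Matrix n n ℂ} {t : ℝ}
    (h : DifferentiableAt ℝ (fun s => hsVec (CFC.sqrt (ρ s))) t) :
    DifferentiableAt ℝ (fun s => CFC.sqrt (ρ s)) t ∧
      speed ρ t = ‖deriv (fun s => hsVec (CFC.sqrt (ρ s))) t‖ := by
  obtain ⟨M', hM'⟩ : ∃ M' : Matrix n n ℂ,
      deriv (fun s => hsVec (CFC.sqrt (ρ s))) t = hsVec M' :=
    ⟨fun j k => deriv (fun s => hsVec (CFC.sqrt (ρ s))) t (j, k), rfl⟩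
  obtain ⟨hdiff, hderiv, hentry⟩ := differentiableAt_and_deriv_of_hsVec (hM' ▸ h.hasDerivAt)
  have hherm : M'ᴴ = M' := by
    ext j k
    have h3 : (fun s => star (CFC.sqrt (ρ s) k j)) = fun s => CFC.sqrt (ρ s) j k := by
      ext s
      exact congrFun (congrFun (conjTranspose_sqrt (ρ s)) j) k
    exact (h3 ▸ (hentry k j).star).unique (hentry j k)
  refine ⟨hdiff, ?_⟩
  rw [speed, hderiv, hM', ← Real.sqrt_sq (norm_nonneg (hsVec M')), norm_hsVec_sq, hherm, sq]

end Imaginarity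

open MeasureTheory Set Imaginarity in
theorem theorem3 {n : Type*} [Fintype n] [DecidableEq n]
    (T : ℝ) (hT : 0 < T) (ρ : ℝ → Matrix n n ℂ)
    (hρ : ∀ t ∈ Set.Icc 0 T, Imaginarity.IsState (ρ t))
    (hac : ∀ j k, AbsolutelyContinuousOnInterval (fun t => CFC.sqrt (ρ t) j k) 0 T) :
    -- the maximum defining the geometric imaginarity is attained, and the angle is the
    -- Bures angle to the nearest real state
    (∀ t ∈ Set.Icc 0 T,
      IsGreatest (Imaginarity.fidelity (ρ t) '' Imaginarity.realStates n)
        (1 - Imaginarity.geomImaginarity (ρ t)) ∧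
      IsLeast (Imaginarity.buresAngle (ρ t) '' Imaginarity.realStates n)
        (Imaginarity.imaginarityAngle (ρ t))) ∧
    -- the average speed is well defined
    (∀ᵐ t ∂MeasureTheory.volume.restrict (Set.Icc 0 T),
      DifferentiableAt ℝ (fun s => CFC.sqrt (ρ s)) t) ∧
    IntervalIntegrable (Imaginarity.speed ρ) MeasureTheory.volume 0 T ∧
    -- the speed limit
    T ≥ |Imaginarity.imaginarityAngle (ρ T) - Imaginarity.imaginarityAngle (ρ 0)| /
      Imaginarity.avgSpeed ρ T ∧
    (Imaginarity.avgSpeed ρ T = 0 →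
      Imaginarity.imaginarityAngle (ρ T) - Imaginarity.imaginarityAngle (ρ 0) = 0) := by
  have hX := absolutelyContinuousOnInterval_hsVec hac
  have hae : ∀ᵐ t, t ∈ Icc 0 T → DifferentiableAt ℝ (fun s => CFC.sqrt (ρ s)) t ∧
      speed ρ t = ‖deriv (fun s => hsVec (CFC.sqrt (ρ s))) t‖ := by
    filter_upwards [hX.ae_differentiableAt_of_finiteDimensional] with t ht htm
    exact speed_eq_norm_deriv (ht (by rwa [uIcc_of_le hT.le]))
  have hspeed : ∀ᵐ t, t ∈ uIoc 0 T →
      ‖deriv (fun s => hsVec (CFC.sqrt (ρ s))) t‖ = speed ρ t := by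
    filter_upwards [hae] with t ht htm
    rw [uIoc_of_le hT.le] at htm
    exact (ht (Ioc_subset_Icc_self htm)).2.symm
  have h0 : (0 : ℝ) ∈ Icc 0 T := ⟨le_rfl, hT.le⟩
  have h1 : T ∈ Icc 0 T := ⟨hT.le, le_rfl⟩
  have hmain : |imaginarityAngle (ρ T) - imaginarityAngle (ρ 0)| ≤ T * avgSpeed ρ T := by
    rw [avgSpeed, ← mul_assoc, mul_one_div_cancel hT.ne', one_mul,
      ← intervalIntegral.integral_congr_ae hspeed]
    have hlen := hX.angle_le_integral_norm_deriv hT fun t ht => norm_hsVec_sqrt (hρ t ht)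
    exact (abs_imaginarityAngle_sub_le (hρ T h1) (hρ 0 h0)).trans hlen
  have havg : 0 ≤ avgSpeed ρ T :=
    mul_nonneg (by positivity)
      (intervalIntegral.integral_nonneg hT.le fun _ _ => Real.sqrt_nonneg _)
  refine ⟨fun t ht => ?_, ?_, ?_, ?_, fun hzero => ?_⟩
  · have := (hρ t ht).nonempty
    exact isGreatest_fidelity_and_isLeast_buresAngle (ρ t)
  · rw [ae_restrict_iff' measurableSet_Icc]
    filter_upwards [hae] with t ht htm using (ht htm).1
  · exact hX.intervalIntegrable_norm_deriv.congr_ae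
      ((ae_restrict_iff' measurableSet_uIoc).2 hspeed)
  · exact div_le_of_le_mul₀ havg hT.le hmain
  · rw [hzero, mul_zero] at hmain
    exact abs_nonpos_iff.1 hmain
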